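/- Let $G$ be a locally convex Lie group, i.e. a group with a smooth manifold structure modelled on a Hausdorff locally convex real vector space (smoothness meaning that all iterated directional derivatives exist and are jointly continuous) for which multiplication and inversion are smooth. Let $\mathcal{H}$ be a complex Hilbert space, let $\mathrm{PU}(\mathcal{H}) = \mathrm{U}(\mathcal{H})/\mathbb{T}\mathbf{1}$ be its projective unitary group, and let $\overline{\rho} \colon G \to \mathrm{PU}(\mathcal{H})$ be a group homomorphism (a projective unitary representation; no continuity is assumed). Let $\mathbb{P}(\mathcal{H})^\infty$ be the set of smooth rays, i.e. of those $[\psi]$ in the Hilbert manifold $\mathbb{P}(\mathcal{H})$ whose orbit map $G \to \mathbb{P}(\mathcal{H})$, $g \mapsto \overline{\rho}(g)[\psi]$, is smooth. Then there exists a family $(\mathcal{D}_j)_{j \in J}$ of mutually orthogonal, not necessarily closed, linear subspaces of $\mathcal{H}$ such that \[ \mathbb{P}(\mathcal{H})^\infty = \bigcup_{j \in J} \mathbb{P}(\mathcal{D}_j). \] In particular, if $\mathbb{P}(\mathcal{H})^\infty$ is dense in $\mathbb{P}(\mathcal{H})$, then $\mathbb{P}(\mathcal{H})^\infty = \mathbb{P}(\mathcal{D})$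 for a dense linear subspace $\mathcal{D} \subseteq \mathcal{H}$. -/

import Mathlib

open Set Filter Topology
open scoped InnerProductSpace LinearAlgebra.Projectivization

universe uE uG uH

noncomputable section

/-! ### Smooth maps between locally convex spaces -/

section SmoothMaps

variable {E F : Type*} [AddCommGroup E] [Module ℝ E] [TopologicalSpace E]
  [AddCommGroup F] [Module ℝ F] [TopologicalSpace F]

/-- The derivative `∂_h f (x) = lim_{t → 0} t⁻¹ (f (x + t h) - f x)` exists and equals `y`. -/
def HasDirectionalDeriv (f : E → F) (y : F) (x h : E) : Prop :=
  Tendsto (fun t : ℝ => t⁻¹ • (f (x + t • h) - f x)) (𝓝[≠] 0) (𝓝 y)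

/-- `f` is a `C^∞`-map on `U` (which is open in all uses) in the sense of Michal and Bastiani:
all iterated directional derivatives
`D^j f (x) (h₁, …, h_j) = (∂_{h_j} ⋯ ∂_{h₁} f) (x)` exist for `x ∈ U`, and they are continuous
as maps `U × E^j → F`. For `j = 0` this is the continuity of `f` on `U`. -/
def IsSmoothOn (f : E → F) (U : Set E) : Prop :=
  ∃ D : (j : ℕ) → E → (Fin j → E) → F,
    (∀ x ∈ U, ∀ v, D 0 x v = f x) ∧
    (∀ j, ∀ x ∈ U, ∀ (v : Fin j → E) (h : E),
      HasDirectionalDeriv (fun y => D j y v) (D (j + 1) x (Fin.snoc v h)) x h) ∧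
    ∀ j, ContinuousOn (fun p : E × (Fin j → E) => D j p.1 p.2) (U ×ˢ univ)

/-- The map `f`, expressed in the chart `e` of its domain and the chart `e'` of its codomain,
is smooth wherever this expression is defined. -/
def IsSmoothInCharts {M N : Type*} [TopologicalSpace M] [TopologicalSpace N]
    (e : OpenPartialHomeomorph M E) (e' : OpenPartialHomeomorph N F) (f : M → N) : Prop :=
  IsSmoothOn (fun x => e' (f (e.symm x))) {x | x ∈ e.target ∧ f (e.symm x) ∈ e'.source}

end SmoothMaps

/-! ### Locally convex Lie groups -/

/-- A locally convex Lie group: a group with a smooth manifold structure modelled on the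
Hausdorff locally convex real vector space `E` for which the multiplication and the inversion
are smooth maps. -/
class LocallyConvexLieGroup (E : Type*) [AddCommGroup E] [Module ℝ E] [TopologicalSpace E]
    [IsTopologicalAddGroup E] [ContinuousSMul ℝ E] [LocallyConvexSpace ℝ E] [T2Space E]
    (G : Type*) [Group G] [TopologicalSpace G] [ChartedSpace E G] : Prop where
  /-- changes of charts are smooth -/
  smooth_transition : ∀ e ∈ atlas E G, ∀ e' ∈ atlas E G, IsSmoothInCharts e e' (id : G → G)
  continuous_mul : Continuous fun p : G × G => p.1 * p.2
  smooth_mul : ∀ e₁ ∈ atlas E G, ∀ e₂ ∈ atlas E G, ∀ e₃ ∈ atlas E G,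
    IsSmoothInCharts (e₁.prod e₂) e₃ fun p : G × G => p.1 * p.2
  continuous_inv : Continuous fun g : G => g⁻¹
  smooth_inv : ∀ e ∈ atlas E G, ∀ e' ∈ atlas E G, IsSmoothInCharts e e' fun g : G => g⁻¹

/-! ### The Hilbert manifold `ℙ(H)` -/

section ProjectiveSpace

variable {H : Type*} [NormedAddCommGroup H] [InnerProductSpace ℂ H]

/-- The quotient topology on the projective space `ℙ(H)`. -/
instance projectiveSpaceTopology : TopologicalSpace (ℙ ℂ H) :=
  TopologicalSpace.coinduced (Projectivization.mk' ℂ : {v : H // v ≠ 0} → ℙ ℂ H) inferInstance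

theorem isQuotientMap_projMk :
    IsQuotientMap (Projectivization.mk' ℂ : {v : H // v ≠ 0} → ℙ ℂ H) :=
  ⟨⟨rfl⟩, Quotient.mk_surjective⟩

/-- The affine coordinate `[ψ] ↦ ⟪φ, ψ⟫⁻¹ ψ - φ` on `ℙ(H)`, with junk value `-φ` for `ψ ⟂ φ`. -/
def projCoord (φ : H) : ℙ ℂ H → H :=
  Projectivization.lift (fun ψ => (⟪φ, (ψ : H)⟫_ℂ)⁻¹ • (ψ : H) - φ) <| by
    rintro ⟨a, ha⟩ ⟨b, hb⟩ t (rfl : a = t • b)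
    have ht : t ≠ 0 := fun h => ha (by simp [h])
    simp only [inner_smul_right, mul_inv, smul_smul]
    rw [mul_right_comm, inv_mul_cancel₀ ht, one_mul]

/-- The rays that are not orthogonal to `φ`. -/
def projChartSource (φ : H) : Set (ℙ ℂ H) := {p | ¬ p.submodule ⟂ (ℂ ∙ φ)}

theorem mk_mem_projChartSource (φ ψ : H) (hψ : ψ ≠ 0) :
    Projectivization.mk ℂ ψ hψ ∈ projChartSource φ ↔ ⟪φ, ψ⟫_ℂ ≠ 0 := by
  simp only [projChartSource, mem_ofPred_eq, Projectivization.submodule_mk, ne_eq, not_iff_not]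
  rw [Submodule.isOrtho_span]
  simp [inner_eq_zero_symm]

theorem isOpen_projChartSource (φ : H) : IsOpen (projChartSource φ) := by
  rw [← isQuotientMap_projMk.isOpen_preimage]
  have : (Projectivization.mk' ℂ : {v : H // v ≠ 0} → ℙ ℂ H) ⁻¹' projChartSource φ =
      {v : {v : H // v ≠ 0} | ⟪φ, (v : H)⟫_ℂ ≠ 0} := by
    ext v
    exact mk_mem_projChartSource φ v v.2
  rw [this]
  exact isOpen_ne_fun (by fun_prop) continuous_const

theorem projCoord_mem (φ : H) (hφ : ‖φ‖ = 1) {p : ℙ ℂ H} (hp : p ∈ projChartSource φ) :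
    projCoord φ p ∈ (ℂ ∙ φ)ᗮ := by
  induction p with | h ψ hψ =>
  rw [mk_mem_projChartSource] at hp
  rw [Submodule.mem_orthogonal_singleton_iff_inner_right]
  simp [projCoord, inner_sub_right, inner_smul_right, inner_self_eq_norm_sq_to_K, hφ, hp]

theorem inner_add_of_mem_orthogonal (φ : H) (hφ : ‖φ‖ = 1) (v : (ℂ ∙ φ)ᗮ) :
    ⟪φ, φ + (v : H)⟫_ℂ = 1 := by
  have := (Submodule.mem_orthogonal_singleton_iff_inner_right).1 v.2
  simp [this, inner_self_eq_norm_sq_to_K, hφ]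

theorem add_ne_zero_of_mem_orthogonal (φ : H) (hφ : ‖φ‖ = 1) (v : (ℂ ∙ φ)ᗮ) :
    φ + (v : H) ≠ 0 := fun h => by
  simpa [h] using inner_add_of_mem_orthogonal φ hφ v

open scoped Classical in
/-- The standard chart of the Hilbert manifold `ℙ(H)` attached to a unit vector `φ`: it maps the
open set of all rays `[ψ]` with `⟪φ, ψ⟫ ≠ 0` onto the Hilbert space `φ^⟂`, by
`[ψ] ↦ ⟪φ, ψ⟫⁻¹ ψ - φ`, with inverse `v ↦ [φ + v]`. These charts form the standard atlas. -/
def projChart (φ : H) (hφ : ‖φ‖ = 1) : OpenPartialHomeomorph (ℙ ℂ H) (ℂ ∙ φ)ᗮ where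
  toFun p := if hp : p ∈ projChartSource φ then ⟨projCoord φ p, projCoord_mem φ hφ hp⟩ else 0
  invFun v := Projectivization.mk ℂ (φ + (v : H)) (add_ne_zero_of_mem_orthogonal φ hφ v)
  source := projChartSource φ
  target := univ
  map_source' _ _ := mem_univ _
  map_target' v _ := by
    rw [mk_mem_projChartSource, inner_add_of_mem_orthogonal φ hφ v]
    exact one_ne_zero
  left_inv' p hp := by
    rw [dif_pos hp]
    induction p with | h ψ hψ =>
    rw [Projectivization.mk_eq_mk_iff']
    exact ⟨(⟪φ, ψ⟫_ℂ)⁻¹, by simp [projCoord]⟩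
  right_inv' v _ := by
    have h1 := inner_add_of_mem_orthogonal φ hφ v
    have hp : Projectivization.mk ℂ (φ + (v : H)) (add_ne_zero_of_mem_orthogonal φ hφ v)
        ∈ projChartSource φ := by
      rw [mk_mem_projChartSource, h1]
      exact one_ne_zero
    rw [dif_pos hp]
    ext
    simp [projCoord, h1]
  open_source := isOpen_projChartSource φ
  open_target := isOpen_univ
  continuousOn_toFun := by
    rw [IsInducing.subtypeVal.continuousOn_iff]
    have : ContinuousOn (projCoord φ) (projChartSource φ) := by
      refine (isQuotientMap_projMk.continuousOn_isOpen_iff (isOpen_projChartSource φ)).2 ?_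
      have h : ContinuousOn
          (fun v : {v : H // v ≠ 0} => (⟪φ, (v : H)⟫_ℂ)⁻¹ • (v : H) - φ)
          ((Projectivization.mk' ℂ : {v : H // v ≠ 0} → ℙ ℂ H) ⁻¹' projChartSource φ) := by
        refine ContinuousOn.sub (ContinuousOn.smul (ContinuousOn.inv₀ ?_ ?_) ?_) ?_
        · fun_prop
        · intro v hv
          exact (mk_mem_projChartSource φ v v.2).1 hv
        · fun_prop
        · fun_prop
      exact h
    refine this.congr fun p hp => ?_
    simp [hp]
  continuousOn_invFun := by
    refine Continuous.continuousOn ?_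
    exact isQuotientMap_projMk.continuous.comp (Continuous.subtype_mk (by fun_prop) _)

end ProjectiveSpace

/-! ### Projective unitary representations and smooth rays -/

section Representations

variable (H : Type*) [NormedAddCommGroup H] [InnerProductSpace ℂ H] [CompleteSpace H]

/-- The subgroup `𝕋 1` of the unitary group `U(H)`. -/
def scalarUnitaries : Subgroup (unitary (H →L[ℂ] H)) where
  carrier := {U | ∃ z : Circle, (U : H →L[ℂ] H) = (z : ℂ) • (1 : H →L[ℂ] H)}
  one_mem' := ⟨1, by simp⟩
  mul_mem' := by
    rintro U V ⟨z, hz⟩ ⟨w, hw⟩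
    exact ⟨z * w, by simp [hz, hw, smul_smul, mul_comm]⟩
  inv_mem' := by
    rintro U ⟨z, hz⟩
    refine ⟨z⁻¹, ?_⟩
    rw [← Unitary.star_eq_inv, Unitary.coe_star, hz, star_smul, star_one, Circle.coe_inv_eq_conj]
    rfl

instance scalarUnitaries_normal : (scalarUnitaries H).Normal where
  conj_mem := by
    rintro U ⟨z, hz⟩ V
    refine ⟨z, ?_⟩
    have : (V : H →L[ℂ] H) * ((V⁻¹ : unitary (H →L[ℂ] H)) : H →L[ℂ] H) = 1 := by
      rw [← Unitary.star_eq_inv]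
      exact Unitary.coe_mul_star_self V
    simp [hz, this]

/-- The projective unitary group `PU(H) = U(H) / 𝕋 1`. -/
abbrev ProjectiveUnitaryGroup := unitary (H →L[ℂ] H) ⧸ scalarUnitaries H

variable {H}

/-- The action of `PU(H)` on `ℙ(H)`: the class of `U` maps `[ψ]` to `[U ψ]`. -/
instance projectiveUnitaryAction : MulAction (ProjectiveUnitaryGroup H) (ℙ ℂ H) where
  smul u p := Quotient.liftOn' u (fun U => U • p) <| by
    intro U V hUV
    obtain ⟨z, hz⟩ := (QuotientGroup.leftRel_apply.1 hUV : U⁻¹ * V ∈ scalarUnitaries H)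
    have hz' : ∀ ψ : H, (U⁻¹ * V) • ψ = (z : ℂ) • ψ := fun ψ => by
      change ((U⁻¹ * V : unitary (H →L[ℂ] H)) : H →L[ℂ] H) ψ = _
      rw [hz]
      rfl
    change U • p = V • p
    rw [← mul_inv_cancel_left U V, mul_smul]
    congr 1
    induction p with | h ψ hψ =>
    rw [Projectivization.smul_mk, eq_comm, Projectivization.mk_eq_mk_iff']
    exact ⟨z, (hz' ψ).symm⟩
  one_smul p := one_smul (unitary (H →L[ℂ] H)) p
  mul_smul u v p := by
    induction u using QuotientGroup.induction_on
    induction v using QuotientGroup.induction_on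
    rename_i U V
    exact mul_smul (U : unitary (H →L[ℂ] H)) V p

theorem projectiveUnitaryAction_mk (U : unitary (H →L[ℂ] H)) (ψ : H) (hψ : ψ ≠ 0)
    (hU : (U : H →L[ℂ] H) ψ ≠ 0) :
    (QuotientGroup.mk U : ProjectiveUnitaryGroup H) • Projectivization.mk ℂ ψ hψ =
      Projectivization.mk ℂ ((U : H →L[ℂ] H) ψ) hU := rfl

/-- The set `ℙ(H)^∞` of smooth rays of a projective unitary representation `ρ` of the Lie group
`G` modelled on `E`: the rays whose orbit map `G → ℙ(H)`, `g ↦ ρ(g)[ψ]`, is a smooth map of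
manifolds. -/
def smoothRays (E : Type*) [AddCommGroup E] [Module ℝ E] [TopologicalSpace E]
    {G : Type*} [Group G] [TopologicalSpace G] [ChartedSpace E G]
    (ρ : G →* ProjectiveUnitaryGroup H) : Set (ℙ ℂ H) :=
  {p | (Continuous fun g : G => ρ g • p) ∧
    ∀ e ∈ atlas E G, ∀ (φ : H) (hφ : ‖φ‖ = 1),
      IsSmoothInCharts e (projChart φ hφ) fun g : G => ρ g • p}

end Representations

end

/-! The crux is that the cone of smooth rays is closed under sums of non-orthogonal vectors. If `v`
and `w` span the images of `[ψ]` and `[φ]` under a unitary, each is known only up to a scalar, so `v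
+ w` says nothing about the image of `[ψ + φ]`. When `⟪ψ, φ⟫ ≠ 0`, preservation of inner products
fixes the relative phase, and `sumLift` gives a representative of that image which is polynomial in
the inner products and vectors. Composing it with local lifts of the two orbit maps shows that `[ψ +
φ]` is smooth (`add_mem_coneOver_smoothRays`).

The rest is Hilbert space geometry. Being linked, i.e. having a common non-orthogonal vector in the
cone, is an equivalence relation on the nonzero vectors of the cone (`IsLinked.trans`), and linked
vectors may be added by a detour (`add_mem_coneOver_of_isLinked`). The classes with `0` adjoined are
thus subspaces. Vectors in different classes are orthogonal, because non-orthogonal ones are linked.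
If the smooth rays are dense, any two nonzero vectors are linked and the whole cone is one subspace.
-/

noncomputable section

/-! ### Calculus of Michal–Bastiani smooth maps into normed spaces -/

section SmoothMapTools

open scoped ContDiff

variable {E F F' : Type*} [AddCommGroup E] [Module ℝ E]
  [NormedAddCommGroup F] [NormedSpace ℝ F] [NormedAddCommGroup F'] [NormedSpace ℝ F']

theorem hasDirectionalDeriv_iff {f : E → F} {y : F} {x h : E} :
    HasDirectionalDeriv f y x h ↔ HasDerivAt (fun t : ℝ => f (x + t • h)) y 0 := by
  rw [hasDerivAt_iff_tendsto_slope_zero]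
  simp [HasDirectionalDeriv]

variable [TopologicalSpace E]

theorem snoc_comp_snoc {α : Type*} {m n : ℕ} (v : Fin n → α) (h : α) (s : Fin m → Fin n) :
    Fin.snoc (α := fun _ => α) v h ∘
      Fin.snoc (α := fun _ => Fin (n + 1)) (fun a => (s a).castSucc) (Fin.last n) =
        Fin.snoc (α := fun _ => α) (v ∘ s) h := by
  funext a
  refine Fin.lastCases ?_ (fun b => ?_) a <;> simp [Function.comp_apply]

theorem IsSmoothOn.mono {f : E → F} {U V : Set E} (hf : IsSmoothOn f U) (hV : V ⊆ U) :
    IsSmoothOn f V := by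
  obtain ⟨D, h0, h1, h2⟩ := hf
  exact ⟨D, fun x hx => h0 x (hV hx), fun j x hx => h1 j x (hV hx),
    fun j => (h2 j).mono (prod_mono hV subset_rfl)⟩

theorem IsSmoothOn.congr {f g : E → F} {U : Set E} (hf : IsSmoothOn f U) (hfg : EqOn g f U) :
    IsSmoothOn g U := by
  obtain ⟨D, h0, h1, h2⟩ := hf
  exact ⟨D, fun x hx v => (h0 x hx v).trans (hfg hx).symm, h1, h2⟩

theorem IsSmoothOn.prodMk {f : E → F} {g : E → F'} {U : Set E} (hf : IsSmoothOn f U)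
    (hg : IsSmoothOn g U) : IsSmoothOn (fun x => (f x, g x)) U := by
  obtain ⟨D, h0, h1, h2⟩ := hf
  obtain ⟨D', h0', h1', h2'⟩ := hg
  refine ⟨fun j x v => (D j x v, D' j x v), fun x hx v => Prod.ext (h0 x hx v) (h0' x hx v),
    fun j x hx v h => ?_, fun j => (h2 j).prodMk (h2' j)⟩
  exact (h1 j x hx v h).prodMk_nhds (h1' j x hx v h)

/-- Postcomposition with a smooth map between normed spaces. -/
theorem IsSmoothOn.comp_contDiffOn {f : E → F} {U : Set E} (hf : IsSmoothOn f U) {W : Set F}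
    (hW : IsOpen W) {Ψ : F → F'} (hΨ : ContDiffOn ℝ ∞ Ψ W) (hfW : MapsTo f U W) :
    IsSmoothOn (fun x => Ψ (f x)) U := by
  obtain ⟨D, h0, h1, h2⟩ := hf
  -- Candidates for the `j`-th derivative: smooth functions of finitely many derivatives of `f`,
  -- each along directions chosen by `σ i`. This class is stable under directional derivatives, so
  -- no explicit higher chain rule is needed.
  let P : (j : ℕ) → (E → (Fin j → E) → F') → Prop := fun j k =>
    ∃ (ι : Type) (_ : Fintype ι) (W : Set (ι → F)) (Ψ : (ι → F) → F') (n : ι → ℕ)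
      (σ : ∀ i, Fin (n i) → Fin j), IsOpen W ∧ ContDiffOn ℝ ∞ Ψ W ∧
        (∀ x ∈ U, ∀ v : Fin j → E, (fun i => D (n i) x (v ∘ σ i)) ∈ W) ∧
        k = fun x v => Ψ (fun i => D (n i) x (v ∘ σ i))
  have hP0 : P 0 fun x _ => Ψ (D 0 x Fin.elim0) := by
    refine ⟨Unit, inferInstance, (fun a => a ()) ⁻¹' W, fun a => Ψ (a ()), fun _ => 0,
      fun _ => id, hW.preimage (by fun_prop), ?_, fun x hx v => ?_, ?_⟩
    · exact hΨ.comp (contDiff_apply ℝ F ()).contDiffOn fun _ h => h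
    · simpa [h0 x hx] using hfW hx
    · ext x v
      rw [Subsingleton.elim (Fin.elim0 : Fin 0 → E) (v ∘ id)]
  have hcont : ∀ j k, P j k → ContinuousOn (fun p : E × (Fin j → E) => k p.1 p.2) (U ×ˢ univ) := by
    rintro j k ⟨ι, _, W, Ψ, n, σ, hW, hΨ, hD, rfl⟩
    refine hΨ.continuousOn.comp (t := W) ?_ fun p hp => hD p.1 hp.1 p.2
    refine continuousOn_pi.2 fun i => ?_
    refine (h2 (n i)).comp (f := fun p : E × (Fin j → E) => (p.1, p.2 ∘ σ i)) ?_ fun p hp => ?_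
    · exact Continuous.continuousOn (by fun_prop)
    · exact ⟨hp.1, trivial⟩
  have hstep : ∀ j k, P j k → ∃ k', P (j + 1) k' ∧ ∀ x ∈ U, ∀ (v : Fin j → E) (h : E),
      HasDirectionalDeriv (fun y => k y v) (k' x (Fin.snoc v h)) x h := by
    rintro j k ⟨ι, _, W, Ψ, n, σ, hW, hΨ, hD, rfl⟩
    -- The chain rule doubles the arguments: `inl` keeps the old derivative, `inr` differentiates it
    -- once more along the new last direction.
    let e' : ι ⊕ ι → Σ n, (Fin n → Fin (j + 1)) := Sum.elim
      (fun i => ⟨n i, fun a => (σ i a).castSucc⟩)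
      fun i => ⟨n i + 1,
        Fin.snoc (α := fun _ => Fin (j + 1)) (fun a => (σ i a).castSucc) (Fin.last j)⟩
    have hl : ∀ (x : E) (v : Fin j → E) (h : E) (i : ι),
        D (e' (.inl i)).1 x (Fin.snoc (α := fun _ => E) v h ∘ (e' (.inl i)).2) =
          D (n i) x (v ∘ σ i) := by
      intro x v h i
      change D (n i) x _ = _
      congr 1
      funext a
      exact Fin.snoc_castSucc (α := fun _ => E) h v (σ i a)
    have hr : ∀ (x : E) (v : Fin j → E) (h : E) (i : ι),
        D (e' (.inr i)).1 x (Fin.snoc (α := fun _ => E) v h ∘ (e' (.inr i)).2) =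
          D (n i + 1) x (Fin.snoc (v ∘ σ i) h) := by
      intro x v h i
      change D (n i + 1) x _ = _
      congr 1
      exact snoc_comp_snoc v h (σ i)
    let Ψ' : (ι ⊕ ι → F) → F' := fun a => fderiv ℝ Ψ (fun i => a (.inl i)) fun i => a (.inr i)
    refine ⟨fun x v => Ψ' fun i => D (e' i).1 x (v ∘ (e' i).2),
      ⟨ι ⊕ ι, inferInstance, (fun a i => a (.inl i)) ⁻¹' W, Ψ', fun i => (e' i).1, fun i => (e' i).2,
      hW.preimage (by fun_prop), ?_, fun x hx v => ?_, rfl⟩, fun x hx v h => ?_⟩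
    · refine ContDiffOn.clm_apply ?_ (ContDiff.contDiffOn (by fun_prop))
      exact (hΨ.fderiv_of_isOpen hW (m := ∞) (by simp)).comp
        (ContDiff.contDiffOn (by fun_prop)) fun _ h => h
    · have := hD x hx (Fin.init v)
      rw [← funext (hl x (Fin.init v) (v (Fin.last j)))] at this
      rwa [Fin.snoc_init_self] at this
    · rw [hasDirectionalDeriv_iff]
      have hd : DifferentiableAt ℝ Ψ (fun i => D (n i) x (v ∘ σ i)) :=
        (hΨ.contDiffAt (hW.mem_nhds (hD x hx v))).differentiableAt (by simp)
      have hc : HasDerivAt (fun t : ℝ => fun i => D (n i) (x + t • h) (v ∘ σ i))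
          (fun i => D (n i + 1) x (Fin.snoc (v ∘ σ i) h)) 0 :=
        hasDerivAt_pi.2 fun i => hasDirectionalDeriv_iff.1 (h1 (n i) x hx (v ∘ σ i) h)
      have hd' : HasFDerivAt Ψ (fderiv ℝ Ψ (fun i => D (n i) x (v ∘ σ i)))
          (fun i => D (n i) (x + (0 : ℝ) • h) (v ∘ σ i)) := by
        simpa using hd.hasFDerivAt
      have := hd'.comp_hasDerivAt (0 : ℝ) hc
      rw [← funext (hl x v h), ← funext (hr x v h)] at this
      exact this
  choose next hnext hder using hstep
  let K : (j : ℕ) → {k // P j k} := fun j =>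
    Nat.rec (motive := fun j => {k // P j k}) ⟨_, hP0⟩ (fun j k => ⟨_, hnext j k.1 k.2⟩) j
  refine ⟨fun j => (K j).1, fun x hx v => ?_, fun j => hder j (K j).1 (K j).2,
    fun j => hcont j _ (K j).2⟩
  change Ψ (D 0 x Fin.elim0) = _
  rw [h0 x hx]

/-- Smoothness is a local property. -/
theorem isSmoothOn_of_locally [IsTopologicalAddGroup E] [ContinuousSMul ℝ E] {f : E → F}
    {U : Set E} (hf : ∀ x ∈ U, ∃ V ⊆ U, IsOpen V ∧ x ∈ V ∧ IsSmoothOn f V) : IsSmoothOn f U := by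
  choose! V hVU hVo hxV D h0 h1 h2 using hf
  have line : ∀ {V : Set E}, IsOpen V → ∀ {x}, x ∈ V → ∀ h : E,
      ∀ᶠ t : ℝ in 𝓝[≠] 0, x + t • h ∈ V := by
    intro V hV x hx h
    have : Continuous fun t : ℝ => x + t • h := by fun_prop
    exact nhdsWithin_le_nhds ((hV.preimage this).mem_nhds (by simpa using hx))
  have deriv_congr : ∀ {V : Set E}, IsOpen V → ∀ {k k' : E → F}, EqOn k k' V → ∀ {x}, x ∈ V →
      ∀ {y h}, HasDirectionalDeriv k y x h → HasDirectionalDeriv k' y x h := by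
    intro V hV k k' hk x hx y h hd
    refine Tendsto.congr' ?_ hd
    filter_upwards [line hV hx h] with t ht
    rw [hk ht, hk hx]
  -- Limits in `F` are unique, so the local families of derivatives agree on overlaps and glue.
  have agree : ∀ j, ∀ a ∈ U, ∀ b ∈ U, ∀ x ∈ V a ∩ V b, ∀ v, D a j x v = D b j x v := by
    intro j a ha b hb
    induction j with
    | zero => intro x hx v; rw [h0 a ha x hx.1, h0 b hb x hx.2]
    | succ j ih =>
      intro x hx v
      rw [← Fin.snoc_init_self v]
      refine tendsto_nhds_unique (h1 a ha j x hx.1 (Fin.init v) (v (Fin.last j))) ?_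
      exact deriv_congr ((hVo a ha).inter (hVo b hb)) (fun y hy => (ih y hy _).symm) hx
        (h1 b hb j x hx.2 (Fin.init v) (v (Fin.last j)))
  have eq_near : ∀ j, ∀ x ∈ U, ∀ y ∈ V x, ∀ v, D x j y v = D y j y v := fun j x hx y hy v =>
    agree j x hx y (hVU x hx hy) y ⟨hy, hxV y (hVU x hx hy)⟩ v
  refine ⟨fun j x v => D x j x v, fun x hx => h0 x hx x (hxV x hx), fun j x hx v h => ?_,
    fun j => ?_⟩
  · exact deriv_congr (hVo x hx) (fun y hy => eq_near j x hx y hy v) (hxV x hx)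
      (h1 x hx j x (hxV x hx) v h)
  · rintro ⟨x, v⟩ ⟨hx, -⟩
    have hV : V x ×ˢ (univ : Set (Fin j → E)) ∈ 𝓝 (x, v) :=
      ((hVo x hx).prod isOpen_univ).mem_nhds ⟨hxV x hx, trivial⟩
    refine (((h2 x hx j).continuousAt hV).congr ?_).continuousWithinAt
    filter_upwards [hV] with p hp
    exact eq_near j x hx p.1 hp.1 p.2

end SmoothMapTools
-- Decomposition of a cone closed under non-orthogonal sums
section OrthogonalComponents

/-- Each of the three conditions excludes at most one value of `t`. -/
theorem exists_ne_zero_add_mul_ne_zero {K : Type*} [Field K] [Infinite K] {a b c d : K}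
    (hab : a ≠ 0 ∨ b ≠ 0) (hcd : c ≠ 0 ∨ d ≠ 0) :
    ∃ t : K, t ≠ 0 ∧ a + t * b ≠ 0 ∧ c + t * d ≠ 0 := by
  have bad : ∀ {a b : K}, (a ≠ 0 ∨ b ≠ 0) → {t : K | a + t * b = 0}.Finite := by
    intro a b h
    refine Set.Subsingleton.finite fun t (ht : _ = _) s (hs : _ = _) => ?_
    have h1 : (t - s) * b = 0 := by linear_combination ht - hs
    rcases mul_eq_zero.1 h1 with h2 | rfl
    · exact sub_eq_zero.1 h2
    · simp_all
  obtain ⟨t, ht⟩ := (((finite_singleton (0 : K)).union (bad hab)).union (bad hcd)).exists_notMem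
  simp only [mem_union, mem_singleton_iff, mem_ofPred_eq, not_or] at ht
  exact ⟨t, ht.1.1, ht.1.2, ht.2⟩

variable {H : Type uH} [NormedAddCommGroup H] [InnerProductSpace ℂ H]

/-- The set of all vectors which vanish or whose ray belongs to `X`. -/
def coneOver (X : Set (ℙ ℂ H)) : Set H := {ψ | ∀ hψ : ψ ≠ 0, Projectivization.mk ℂ ψ hψ ∈ X}

/-- Some vector of the set `S` is orthogonal neither to `ψ` nor to `φ`. -/
def IsLinked (S : Set H) (ψ φ : H) : Prop := ∃ χ ∈ S, ⟪ψ, χ⟫_ℂ ≠ 0 ∧ ⟪φ, χ⟫_ℂ ≠ 0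

variable {X : Set (ℙ ℂ H)} {ψ φ η : H}

theorem zero_mem_coneOver : (0 : H) ∈ coneOver X := fun h => (h rfl).elim

theorem smul_mem_coneOver (hψ : ψ ∈ coneOver X) (t : ℂ) : t • ψ ∈ coneOver X := by
  intro h
  have hψ0 : ψ ≠ 0 := fun h0 => h (by simp [h0])
  convert hψ hψ0 using 1
  rw [Projectivization.mk_eq_mk_iff']
  exact ⟨t, rfl⟩

theorem IsLinked.symm {S : Set H} (h : IsLinked S ψ φ) : IsLinked S φ ψ :=
  let ⟨χ, hχ, h1, h2⟩ := h
  ⟨χ, hχ, h2, h1⟩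

theorem isLinked_of_inner_ne_zero {S : Set H} (hφ : φ ∈ S) (h : ⟪ψ, φ⟫_ℂ ≠ 0) :
    IsLinked S ψ φ :=
  ⟨φ, hφ, h, inner_self_ne_zero.2 fun h0 => h (by simp [h0])⟩

/-- A generic combination `χ₁ + t • χ₂` is orthogonal to neither end, and it lies in the cone
because `χ₁` and `χ₂` are not orthogonal. -/
theorem isLinked_of_path
    (hX : ∀ ψ ∈ coneOver X, ∀ φ ∈ coneOver X, ⟪ψ, φ⟫_ℂ ≠ 0 → ψ + φ ∈ coneOver X)
    {χ₁ χ₂ : H} (h₁ : χ₁ ∈ coneOver X) (h₂ : χ₂ ∈ coneOver X)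
    (hψ : ⟪ψ, χ₁⟫_ℂ ≠ 0) (h : ⟪χ₁, χ₂⟫_ℂ ≠ 0) (hφ : ⟪φ, χ₂⟫_ℂ ≠ 0) :
    IsLinked (coneOver X) ψ φ := by
  obtain ⟨t, ht, h3, h4⟩ := exists_ne_zero_add_mul_ne_zero (Or.inl hψ : _ ∨ ⟪ψ, χ₂⟫_ℂ ≠ 0)
    (Or.inr hφ : ⟪φ, χ₁⟫_ℂ ≠ 0 ∨ _)
  refine ⟨χ₁ + t • χ₂, hX _ h₁ _ (smul_mem_coneOver h₂ t) ?_, ?_, ?_⟩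
  · simp [ht, h]
  · simpa [inner_add_right, inner_smul_right] using h3
  · simpa [inner_add_right, inner_smul_right] using h4

/-- Along the path `ψ, χ, φ, χ', η` consecutive vectors are non-orthogonal; shortening it twice with
`isLinked_of_path` leaves a single intermediate vector. -/
theorem IsLinked.trans
    (hX : ∀ ψ ∈ coneOver X, ∀ φ ∈ coneOver X, ⟪ψ, φ⟫_ℂ ≠ 0 → ψ + φ ∈ coneOver X)
    (hφ : φ ∈ coneOver X) (h : IsLinked (coneOver X) ψ φ) (h' : IsLinked (coneOver X) φ η) :
    IsLinked (coneOver X) ψ η := by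
  obtain ⟨χ, hχ, h1, h2⟩ := h
  obtain ⟨χ', hχ', h3, h4⟩ := h'
  obtain ⟨ξ, hξ, h5, h6⟩ := isLinked_of_path hX hχ hφ h1 (by rwa [ne_eq, inner_eq_zero_symm])
    (by rwa [ne_eq, inner_eq_zero_symm] : ⟪χ', φ⟫_ℂ ≠ 0)
  exact isLinked_of_path hX hξ hχ' h5 (by rwa [ne_eq, inner_eq_zero_symm]) h4

/-- Write `ψ + φ = -t • χ + (φ + (ψ + t • χ))` with `χ` the linking vector; for generic `t` every
addition on the right is of non-orthogonal vectors. -/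
theorem add_mem_coneOver_of_isLinked
    (hX : ∀ ψ ∈ coneOver X, ∀ φ ∈ coneOver X, ⟪ψ, φ⟫_ℂ ≠ 0 → ψ + φ ∈ coneOver X)
    (hψ : ψ ∈ coneOver X) (hφ : φ ∈ coneOver X) (h : IsLinked (coneOver X) ψ φ) :
    ψ + φ ∈ coneOver X := by
  obtain ⟨χ, hχ, h1, h2⟩ := h
  have hχ0 : ⟪χ, χ⟫_ℂ ≠ 0 := inner_self_ne_zero.2 fun h0 => h1 (by simp [h0])
  obtain ⟨t, ht, h3, h4⟩ := exists_ne_zero_add_mul_ne_zero (Or.inr h2 : ⟪φ, ψ⟫_ℂ ≠ 0 ∨ _)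
    (Or.inr hχ0 : ⟪χ, φ + ψ⟫_ℂ ≠ 0 ∨ _)
  have h5 : ψ + t • χ ∈ coneOver X :=
    hX _ hψ _ (smul_mem_coneOver hχ t) (by simp [ht, h1])
  have h6 : φ + (ψ + t • χ) ∈ coneOver X :=
    hX _ hφ _ h5 (by simpa [inner_add_right, inner_smul_right] using h3)
  have h7 : (-t) • χ + (φ + (ψ + t • χ)) ∈ coneOver X := by
    refine hX _ (smul_mem_coneOver hχ (-t)) _ h6 ?_
    rw [inner_smul_left]
    refine mul_ne_zero (by simpa using ht) ?_
    rw [← add_assoc, inner_add_right, inner_smul_right]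
    exact h4
  convert h7 using 1
  module

/-- The vectors of the cone over `X` which are linked to `ψ`, together with `0`. -/
def linkedComponent
    (hX : ∀ ψ ∈ coneOver X, ∀ φ ∈ coneOver X, ⟪ψ, φ⟫_ℂ ≠ 0 → ψ + φ ∈ coneOver X)
    (hψ : ψ ∈ coneOver X) : Submodule ℂ H where
  carrier := {φ | φ ∈ coneOver X ∧ (φ = 0 ∨ IsLinked (coneOver X) ψ φ)}
  zero_mem' := ⟨zero_mem_coneOver, Or.inl rfl⟩
  smul_mem' := by
    rintro t φ ⟨hφ, h⟩
    refine ⟨smul_mem_coneOver hφ t, ?_⟩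
    rcases eq_or_ne t 0 with rfl | ht
    · simp
    · refine h.imp (by rintro rfl; simp) ?_
      rintro ⟨χ, hχ, h1, h2⟩
      exact ⟨χ, hχ, h1, by simp [ht, h2]⟩
  add_mem' := by
    rintro φ η ⟨hφ, h⟩ ⟨hη, h'⟩
    rcases h with rfl | h <;> rcases h' with rfl | h'
    · rw [add_zero]; exact ⟨hφ, Or.inl rfl⟩
    · rw [zero_add]; exact ⟨hη, Or.inr h'⟩
    · rw [add_zero]; exact ⟨hφ, Or.inr h⟩
    have hs := add_mem_coneOver_of_isLinked hX hφ hη (h.symm.trans hX hψ h')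
    refine ⟨hs, or_iff_not_imp_left.2 fun h0 => ?_⟩
    -- A nonzero `φ + η` cannot be orthogonal to both `φ` and `η`, so it is linked to one of them.
    by_cases h1 : ⟪φ, φ + η⟫_ℂ = 0
    · refine h'.trans hX hη (isLinked_of_inner_ne_zero hs fun h2 => h0 ?_)
      rw [← inner_self_eq_zero (𝕜 := ℂ), inner_add_left, h1, h2, add_zero]
    · exact h.trans hX hφ (isLinked_of_inner_ne_zero hs h1)

theorem exists_orthogonal_family
    (hX : ∀ ψ ∈ coneOver X, ∀ φ ∈ coneOver X, ⟪ψ, φ⟫_ℂ ≠ 0 → ψ + φ ∈ coneOver X) :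
    ∃ (J : Type uH) (D : J → Submodule ℂ H), Pairwise (fun i j => D i ⟂ D j) ∧
      X = ⋃ j, ((D j).projectivization : Set (ℙ ℂ H)) := by
  -- Indexing by the subspaces themselves lets linked vectors share one index, as pairwise
  -- orthogonality requires.
  refine ⟨{D : Submodule ℂ H // ∃ (ψ : H) (hψ : ψ ∈ coneOver X), ψ ≠ 0 ∧
    D = linkedComponent hX hψ}, Subtype.val, ?_, ?_⟩
  · rintro ⟨_, ψ, hψ, -, rfl⟩ ⟨_, φ, hφ, -, rfl⟩
    contrapose
    beta_reduce
    rw [Submodule.isOrtho_iff_inner_eq]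
    intro h
    push Not at h
    obtain ⟨a, ⟨ha, h1⟩, b, ⟨hb, h2⟩, hab⟩ := h
    replace h1 := h1.resolve_left fun h0 => hab (by simp [h0])
    replace h2 := h2.resolve_left fun h0 => hab (by simp [h0])
    have h3 : IsLinked (coneOver X) ψ φ :=
      (h1.trans hX ha (isLinked_of_inner_ne_zero hb hab)).trans hX hb h2.symm
    refine Subtype.ext (Submodule.ext fun x => ?_)
    exact and_congr_right fun _ => or_congr_right
      ⟨fun h => h3.symm.trans hX hψ h, fun h => h3.trans hX hφ h⟩
  · ext p
    induction p with | h ψ hψ =>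
    simp only [mem_iUnion, SetLike.mem_coe, Submodule.mk_mem_projectivization_iff]
    constructor
    · intro h
      have hψX : ψ ∈ coneOver X := fun _ => h
      exact ⟨⟨_, ψ, hψX, hψ, rfl⟩, hψX,
        Or.inr (isLinked_of_inner_ne_zero hψX (inner_self_ne_zero.2 hψ))⟩
    · rintro ⟨⟨_, φ, hφ, -, rfl⟩, h, -⟩
      exact h hψ

theorem exists_dense_submodule (hd : Dense X)
    (hX : ∀ ψ ∈ coneOver X, ∀ φ ∈ coneOver X, ⟪ψ, φ⟫_ℂ ≠ 0 → ψ + φ ∈ coneOver X) :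
    ∃ D : Submodule ℂ H, Dense (D : Set H) ∧ X = (D.projectivization : Set (ℙ ℂ H)) := by
  -- The rays orthogonal to neither vector form a nonempty open set, which the dense set `X` meets.
  have linked : ∀ ψ φ : H, ψ ≠ 0 → φ ≠ 0 → IsLinked (coneOver X) ψ φ := by
    intro ψ φ hψ hφ
    obtain ⟨t, -, h1, h2⟩ := exists_ne_zero_add_mul_ne_zero
      (Or.inl (inner_self_ne_zero.2 hψ) : _ ∨ ⟪ψ, φ⟫_ℂ ≠ 0)
      (Or.inr (inner_self_ne_zero.2 hφ) : ⟪φ, ψ⟫_ℂ ≠ 0 ∨ _)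
    rw [← inner_smul_right, ← inner_add_right] at h1 h2
    have h0 : ψ + t • φ ≠ 0 := fun h => h1 (by simp [h])
    obtain ⟨p, ⟨hp1, hp2⟩, hp⟩ := hd.inter_open_nonempty _
      ((isOpen_projChartSource ψ).inter (isOpen_projChartSource φ))
      ⟨Projectivization.mk ℂ _ h0, (mk_mem_projChartSource _ _ _).2 h1,
        (mk_mem_projChartSource _ _ _).2 h2⟩
    induction p with | h χ hχ =>
    exact ⟨χ, fun _ => hp, (mk_mem_projChartSource _ _ _).1 hp1,
      (mk_mem_projChartSource _ _ _).1 hp2⟩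
  let D : Submodule ℂ H :=
    { carrier := coneOver X
      zero_mem' := zero_mem_coneOver
      smul_mem' := fun t ψ hψ => smul_mem_coneOver hψ t
      add_mem' := by
        intro ψ φ hψ hφ
        rcases eq_or_ne ψ 0 with rfl | hψ0
        · simpa using hφ
        rcases eq_or_ne φ 0 with rfl | hφ0
        · simpa using hψ
        exact add_mem_coneOver_of_isLinked hX hψ hφ (linked ψ φ hψ0 hφ0) }
  refine ⟨D, ?_, ?_⟩
  · have unit : ∀ φ : H, ‖φ‖ = 1 → φ ∈ D.topologicalClosure := by
      intro φ hφ
      have hφ0 : φ ≠ 0 := norm_ne_zero_iff.1 (by simp [hφ])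
      have hmem : Projectivization.mk ℂ φ hφ0 ∈ projChartSource φ :=
        (mk_mem_projChartSource _ _ _).2 (inner_self_ne_zero.2 hφ0)
      -- This local lift of rays to vectors sends `[φ]` to `φ`, so it carries density from `ℙ(H)` to
      -- `H`.
      have hc : ContinuousAt (fun p => φ + (projChart φ hφ p : H))
          (Projectivization.mk ℂ φ hφ0) :=
        continuousAt_const.add (continuous_subtype_val.continuousAt.comp
          ((projChart φ hφ).continuousAt hmem))
      have hval : φ + (projChart φ hφ (Projectivization.mk ℂ φ hφ0) : H) = φ := by
        simp [projChart, hmem, projCoord, inner_self_eq_norm_sq_to_K, hφ]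
      have h1 : Projectivization.mk ℂ φ hφ0 ∈ closure (X ∩ projChartSource φ) :=
        inter_comm X _ ▸ hd.open_subset_closure_inter (isOpen_projChartSource φ) hmem
      have h2 := mem_closure_image hc h1
      rw [hval] at h2
      refine closure_mono ?_ h2
      rintro _ ⟨p, ⟨hpX, hp⟩, rfl⟩ h0
      have : Projectivization.mk ℂ _ h0 = p := (projChart φ hφ).left_inv hp
      rwa [this]
    intro φ
    rcases eq_or_ne φ 0 with rfl | hφ
    · exact subset_closure D.zero_mem
    · have := D.topologicalClosure.smul_mem (‖φ‖ : ℂ)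
        (unit (((‖φ‖⁻¹ : ℝ) : ℂ) • φ) (by simp [norm_smul, hφ]))
      rwa [smul_smul, ← Complex.ofReal_mul, mul_inv_cancel₀ (norm_ne_zero_iff.2 hφ),
        Complex.ofReal_one, one_smul] at this
  · ext p
    induction p with | h ψ hψ =>
    exact ⟨fun h _ => h, fun h => h hψ⟩

end OrthogonalComponents
-- Sums of non-orthogonal smooth rays are smooth
section SmoothRays

open scoped ContDiff

variable {H : Type uH} [NormedAddCommGroup H] [InnerProductSpace ℂ H]

/-- If `v` and `w` represent the images of the rays of `ψ` and `φ` under a unitary operator, then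
this vector represents the image of the ray of `ψ + φ`. -/
def sumLift (ψ φ v w : H) : H := (⟪ψ, ψ⟫_ℂ * ⟪v, w⟫_ℂ) • v + (⟪ψ, φ⟫_ℂ * ⟪v, v⟫_ℂ) • w

/-- The weights in `sumLift` absorb the unknown scalars `c` and `d` into one common factor. -/
theorem sumLift_smul_smul (ψ φ v w : H) {c d : ℂ} (hψ : ψ = c • v) (hφ : φ = d • w) :
    sumLift ψ φ v w = (starRingEnd ℂ c * ⟪v, v⟫_ℂ * ⟪v, w⟫_ℂ) • (ψ + φ) := by
  subst hψ hφ
  simp only [sumLift, inner_smul_left, inner_smul_right]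
  module

theorem contDiff_sumLift (ψ φ : H) : ContDiff ℝ ∞ fun p : H × H => sumLift ψ φ p.1 p.2 := by
  have h1 : ContDiff ℝ ∞ fun p : H × H => ⟪p.1, p.2⟫_ℂ := contDiff_fst.inner ℂ contDiff_snd
  have h2 : ContDiff ℝ ∞ fun p : H × H => ⟪p.1, p.1⟫_ℂ := contDiff_fst.inner ℂ contDiff_fst
  exact ((contDiff_const.mul h1).smul contDiff_fst).add
    ((contDiff_const.mul h2).smul contDiff_snd)

/-- The projection only serves to land in the subspace by a total linear map; for unit `χ` its
argument already lies there (`projChart_mk`). -/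
theorem contDiffOn_projCoord (χ : H) :
    ContDiffOn ℝ ∞ (fun u : H => (ℂ ∙ χ)ᗮ.orthogonalProjectionOnto ((⟪χ, u⟫_ℂ)⁻¹ • u - χ))
      {u | ⟪χ, u⟫_ℂ ≠ 0} := by
  have h1 : ContDiff ℝ ∞ fun u : H => ⟪χ, u⟫_ℂ := contDiff_const.inner ℂ contDiff_id
  have h2 : ContDiffOn ℝ ∞ (fun u : H => (⟪χ, u⟫_ℂ)⁻¹ • u - χ) {u | ⟪χ, u⟫_ℂ ≠ 0} :=
    ((h1.contDiffOn.inv fun u hu => hu).smul contDiffOn_id).sub contDiffOn_const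
  exact ((ℂ ∙ χ)ᗮ.orthogonalProjectionOnto.restrictScalars ℝ).contDiff.comp_contDiffOn h2

theorem projChart_mk (χ : H) (hχ : ‖χ‖ = 1) (u : H) (hu : u ≠ 0) (h : ⟪χ, u⟫_ℂ ≠ 0) :
    projChart χ hχ (Projectivization.mk ℂ u hu) =
      (ℂ ∙ χ)ᗮ.orthogonalProjectionOnto ((⟪χ, u⟫_ℂ)⁻¹ • u - χ) := by
  have hm := (mk_mem_projChartSource χ u hu).2 h
  have h1 := projCoord_mem χ hχ hm
  have h2 : projChart χ hχ (Projectivization.mk ℂ u hu) = ⟨_, h1⟩ := dif_pos hm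
  rw [h2]
  exact ((ℂ ∙ χ)ᗮ.orthogonalProjectionOnto_mem_subspace_eq_self ⟨_, h1⟩).symm

theorem mk_add_projChart (χ : H) (hχ : ‖χ‖ = 1) {p : ℙ ℂ H} (hp : p ∈ projChartSource χ) :
    Projectivization.mk ℂ (χ + (projChart χ hχ p : H))
      (add_ne_zero_of_mem_orthogonal χ hχ _) = p :=
  (projChart χ hχ).left_inv hp

theorem exists_mem_projChartSource (p : ℙ ℂ H) :
    ∃ χ : H, ‖χ‖ = 1 ∧ p ∈ projChartSource χ := by
  induction p with | h ψ hψ =>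
  refine ⟨((‖ψ‖⁻¹ : ℝ) : ℂ) • ψ, by simp [norm_smul, hψ], ?_⟩
  rw [mk_mem_projChartSource, inner_smul_left]
  simp [hψ]

variable [CompleteSpace H]

/-- The vector `sumLift ψ φ v w` represents the image of the ray of `ψ + φ`. -/
theorem smul_mk_add (u : ProjectiveUnitaryGroup H) {ψ φ v w : H} (hψ : ψ ≠ 0) (hφ : φ ≠ 0)
    (hs : ψ + φ ≠ 0) (hv : v ≠ 0) (hw : w ≠ 0) (h : ⟪ψ, φ⟫_ℂ ≠ 0)
    (h1 : u • Projectivization.mk ℂ ψ hψ = Projectivization.mk ℂ v hv)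
    (h2 : u • Projectivization.mk ℂ φ hφ = Projectivization.mk ℂ w hw) :
    ∃ h0 : sumLift ψ φ v w ≠ 0,
      u • Projectivization.mk ℂ (ψ + φ) hs = Projectivization.mk ℂ (sumLift ψ φ v w) h0 := by
  induction u using QuotientGroup.induction_on with | H U =>
  have inj : ∀ x : H, x ≠ 0 → (U : H →L[ℂ] H) x ≠ 0 := fun x hx h0 =>
    hx (norm_eq_zero.1 (by rw [← ContinuousLinearMap.norm_map_of_mem_unitary U.2 x, h0, norm_zero]))
  have hin : ∀ x y : H, ⟪(U : H →L[ℂ] H) x, (U : H →L[ℂ] H) y⟫_ℂ = ⟪x, y⟫_ℂ :=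
    ContinuousLinearMap.inner_map_map_of_mem_unitary U.2
  rw [projectiveUnitaryAction_mk U _ _ (inj _ hψ), Projectivization.mk_eq_mk_iff'] at h1
  rw [projectiveUnitaryAction_mk U _ _ (inj _ hφ), Projectivization.mk_eq_mk_iff'] at h2
  obtain ⟨c, hc⟩ := h1
  obtain ⟨d, hd⟩ := h2
  have key := sumLift_smul_smul _ _ v w hc.symm hd.symm
  -- Unitarity removes `U` from the weights, so the vector formed from `U ψ` and `U φ` is the one
  -- formed from `ψ` and `φ`.
  simp only [sumLift, hin] at key
  rw [← map_add] at key
  have hne : starRingEnd ℂ c * ⟪v, v⟫_ℂ * ⟪v, w⟫_ℂ ≠ 0 := by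
    rw [← hin, ← hc, ← hd, inner_smul_left, inner_smul_right] at h
    have h3 := mul_ne_zero_iff.1 h
    exact mul_ne_zero (mul_ne_zero h3.1 (inner_self_ne_zero.2 hv)) (mul_ne_zero_iff.1 h3.2).2
  change sumLift ψ φ v w = _ at key
  refine ⟨by rw [key]; exact smul_ne_zero hne (inj _ hs), ?_⟩
  rw [projectiveUnitaryAction_mk U _ _ (inj _ hs), eq_comm, Projectivization.mk_eq_mk_iff']
  exact ⟨_, key.symm⟩

theorem add_mem_coneOver_smoothRays {E : Type uE} [AddCommGroup E] [Module ℝ E]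
    [TopologicalSpace E] [IsTopologicalAddGroup E] [ContinuousSMul ℝ E]
    {G : Type uG} [Group G] [TopologicalSpace G] [ChartedSpace E G]
    (ρ : G →* ProjectiveUnitaryGroup H) {ψ φ : H} (hψ : ψ ∈ coneOver (smoothRays E ρ))
    (hφ : φ ∈ coneOver (smoothRays E ρ)) (h : ⟪ψ, φ⟫_ℂ ≠ 0) :
    ψ + φ ∈ coneOver (smoothRays E ρ) := by
  intro hs
  have hψ0 : ψ ≠ 0 := fun h0 => h (by simp [h0])
  have hφ0 : φ ≠ 0 := fun h0 => h (by simp [h0])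
  let p := Projectivization.mk ℂ ψ hψ0
  let q := Projectivization.mk ℂ φ hφ0
  obtain ⟨hpc, hps⟩ := hψ hψ0
  obtain ⟨hqc, hqs⟩ := hφ hφ0
  let O : H → H → Set G := fun χ₁ χ₂ =>
    {g | ρ g • p ∈ projChartSource χ₁ ∧ ρ g • q ∈ projChartSource χ₂}
  have hO : ∀ χ₁ χ₂, IsOpen (O χ₁ χ₂) := fun χ₁ χ₂ =>
    ((isOpen_projChartSource χ₁).preimage hpc).inter ((isOpen_projChartSource χ₂).preimage hqc)
  have lift : ∀ χ₁ χ₂ (h₁ : ‖χ₁‖ = 1) (h₂ : ‖χ₂‖ = 1), ∀ g ∈ O χ₁ χ₂,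
      ∃ h0 : sumLift ψ φ (χ₁ + (projChart χ₁ h₁ (ρ g • p) : H))
        (χ₂ + (projChart χ₂ h₂ (ρ g • q) : H)) ≠ 0,
        ρ g • Projectivization.mk ℂ (ψ + φ) hs = Projectivization.mk ℂ _ h0 :=
    fun χ₁ χ₂ h₁ h₂ g hg => smul_mk_add (ρ g) hψ0 hφ0 hs _ _ h
      (mk_add_projChart χ₁ h₁ hg.1).symm (mk_add_projChart χ₂ h₂ hg.2).symm
  have hcont : Continuous fun g : G => ρ g • Projectivization.mk ℂ (ψ + φ) hs := by
    refine continuous_iff_continuousAt.2 fun g₀ => ?_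
    obtain ⟨χ₁, h₁, hm₁⟩ := exists_mem_projChartSource (ρ g₀ • p)
    obtain ⟨χ₂, h₂, hm₂⟩ := exists_mem_projChartSource (ρ g₀ • q)
    refine ContinuousOn.continuousAt (s := O χ₁ χ₂) ?_ ((hO χ₁ χ₂).mem_nhds ⟨hm₁, hm₂⟩)
    rw [continuousOn_iff_continuous_domRestrict]
    have hc₁ : Continuous fun g : O χ₁ χ₂ => projChart χ₁ h₁ (ρ (g : G) • p) :=
      (projChart χ₁ h₁).continuousOn.comp_continuous (hpc.comp continuous_subtype_val)
        fun g => g.2.1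
    have hc₂ : Continuous fun g : O χ₁ χ₂ => projChart χ₂ h₂ (ρ (g : G) • q) :=
      (projChart χ₂ h₂).continuousOn.comp_continuous (hqc.comp continuous_subtype_val)
        fun g => g.2.2
    have hl : Continuous fun g : O χ₁ χ₂ => sumLift ψ φ
        (χ₁ + (projChart χ₁ h₁ (ρ (g : G) • p) : H))
        (χ₂ + (projChart χ₂ h₂ (ρ (g : G) • q) : H)) := (contDiff_sumLift ψ φ).continuous.comp
      ((continuous_const.add (continuous_subtype_val.comp hc₁)).prodMk
        (continuous_const.add (continuous_subtype_val.comp hc₂)))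
    refine (isQuotientMap_projMk.continuous.comp
      (hl.subtype_mk fun g => (lift χ₁ χ₂ h₁ h₂ g g.2).1)).congr fun g => ?_
    exact (lift χ₁ χ₂ h₁ h₂ g g.2).2.symm
  refine ⟨hcont, fun e he χ hχ => isSmoothOn_of_locally fun x₀ hx₀ => ?_⟩
  obtain ⟨χ₁, h₁, hm₁⟩ := exists_mem_projChartSource (ρ (e.symm x₀) • p)
  obtain ⟨χ₂, h₂, hm₂⟩ := exists_mem_projChartSource (ρ (e.symm x₀) • q)
  -- On `V` both orbit maps lift through fixed charts and the orbit of `[ψ + φ]` stays in the chart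
  -- at `χ`; its coordinate is then a smooth function of the other two.
  let V : Set E := e.target ∩ e.symm ⁻¹' (O χ₁ χ₂ ∩
    (fun g : G => ρ g • Projectivization.mk ℂ (ψ + φ) hs) ⁻¹' projChartSource χ)
  refine ⟨V, fun x hx => ⟨hx.1, hx.2.2⟩, e.symm.isOpen_inter_preimage
    ((hO χ₁ χ₂).inter ((isOpen_projChartSource χ).preimage hcont)),
    ⟨hx₀.1, ⟨hm₁, hm₂⟩, hx₀.2⟩, ?_⟩
  have hsm := ((hps e he χ₁ h₁).mono (V := V) fun x hx => ⟨hx.1, hx.2.1.1⟩).prodMk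
    ((hqs e he χ₂ h₂).mono (V := V) fun x hx => ⟨hx.1, hx.2.1.2⟩)
  have hL : ContDiff ℝ ∞ fun a : (ℂ ∙ χ₁)ᗮ × (ℂ ∙ χ₂)ᗮ =>
      sumLift ψ φ (χ₁ + (a.1 : H)) (χ₂ + (a.2 : H)) := by
    have s₁ : ContDiff ℝ ∞ fun a : (ℂ ∙ χ₁)ᗮ × (ℂ ∙ χ₂)ᗮ => (a.1 : H) :=
      ((ℂ ∙ χ₁)ᗮ.subtypeL.restrictScalars ℝ).contDiff.comp contDiff_fst
    have s₂ : ContDiff ℝ ∞ fun a : (ℂ ∙ χ₁)ᗮ × (ℂ ∙ χ₂)ᗮ => (a.2 : H) :=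
      ((ℂ ∙ χ₂)ᗮ.subtypeL.restrictScalars ℝ).contDiff.comp contDiff_snd
    exact (contDiff_sumLift ψ φ).comp
      ((contDiff_const.add s₁).prodMk (contDiff_const.add s₂))
  have hmem : ∀ x ∈ V, ⟪χ, sumLift ψ φ (χ₁ + (projChart χ₁ h₁ (ρ (e.symm x) • p) : H))
      (χ₂ + (projChart χ₂ h₂ (ρ (e.symm x) • q) : H))⟫_ℂ ≠ 0 := by
    intro x hx
    obtain ⟨h0, h3⟩ := lift χ₁ χ₂ h₁ h₂ _ hx.2.1
    rw [← mk_mem_projChartSource χ _ h0, ← h3]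
    exact hx.2.2
  refine (hsm.comp_contDiffOn
    (W := {a | ⟪χ, sumLift ψ φ (χ₁ + (a.1 : H)) (χ₂ + (a.2 : H))⟫_ℂ ≠ 0}) ?_
    ((contDiffOn_projCoord χ).comp hL.contDiffOn fun _ ha => ha) hmem).congr fun x hx => ?_
  · exact isOpen_ne_fun (continuous_const.inner hL.continuous) continuous_const
  · obtain ⟨h0, h3⟩ := lift χ₁ χ₂ h₁ h₂ _ hx.2.1
    beta_reduce
    rw [h3]
    exact projChart_mk χ hχ _ h0 (hmem x hx)

end SmoothRays
end

theorem theorem5p4 {E : Type uE} [AddCommGroup E] [Module ℝ E] [TopologicalSpace E]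
    [IsTopologicalAddGroup E] [ContinuousSMul ℝ E] [LocallyConvexSpace ℝ E] [T2Space E]
    {G : Type uG} [Group G] [TopologicalSpace G] [ChartedSpace E G] [LocallyConvexLieGroup E G]
    {H : Type uH} [NormedAddCommGroup H] [InnerProductSpace ℂ H] [CompleteSpace H]
    (ρ : G →* ProjectiveUnitaryGroup H) :
    (∃ (J : Type uH) (D : J → Submodule ℂ H),
      Pairwise (fun i j => D i ⟂ D j) ∧
      smoothRays E ρ = ⋃ j, ((D j).projectivization : Set (ℙ ℂ H))) ∧
    (Dense (smoothRays E ρ) →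
      ∃ D : Submodule ℂ H, Dense (D : Set H) ∧
        smoothRays E ρ = (D.projectivization : Set (ℙ ℂ H))) := by
  have hX : ∀ ψ ∈ coneOver (smoothRays E ρ), ∀ φ ∈ coneOver (smoothRays E ρ), ⟪ψ, φ⟫_ℂ ≠ 0 →
      ψ + φ ∈ coneOver (smoothRays E ρ) :=
    fun _ hψ _ hφ h => add_mem_coneOver_smoothRays ρ hψ hφ h
  exact ⟨exists_orthogonal_family hX, fun hd => exists_dense_submodule hd hX⟩
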